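/- Let $d\ge 1$ and let $P_d=\{x\in\mathbf R^d : x_i\ge 0,\ \sum_i x_i=1\}$ be the set of $d$-dimensional probability vectors. Vectors of finite dimension are identified with the finitely supported sequences obtained by appending zeros, and $\|\cdot\|_1$ denotes the $\ell_1$-norm. For $x \in P_d$ and $p\in\mathbf R$ put $N_p(x)=\sum_{i:\,x_i>0}x_i^p$. For finite-dimensional probability vectors $u,v$ (brought to a common dimension $m$ by appending zeros) write $u\prec v$ ($u$ is majorized by $v$) if $\sum_{i=1}^k u_i^\downarrow\le\sum_{i=1}^k v_i^\downarrow$ for all $1\le k\le m$, where $u^\downarrow$ is the decreasing rearrangement of $u$. For $u\in P_e$ and $k\ge 1$ let $u^{\otimes k}\in P_{e^k}$ be the $k$-fold tensor power, i.e. the vector with coordinates $u_{i_1}\cdots u_{i_k}$, $1\le i_1,\dots,i_k\le e$. Let $x,y\in P_d$ satisfy $N_p(x)\le N_p(y)$ for all real $p\ge 1$. Then there exists a sequence $(x_n)_{n}$ of probability vectors of finite, but possibly varying, dimensions $e_n$, $x_n\in P_{e_n}$, such that for every $n$ there is an integer $k\ge 1$ with $x_n^{\otimes k}\prec y^{\otimes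 k}$, and $\|x_n-x\|_1\to 0$ as $n\to\infty$. -/

import Mathlib

open Filter Topology

noncomputable section

namespace Catalysis

/-- The set `P_d` of `d`-dimensional probability vectors. -/
def P (d : ℕ) : Set (Fin d → ℝ) :=
  stdSimplex ℝ (Fin d)

/-- The decreasing rearrangement of a finite family of reals: its values (with multiplicity)
listed in decreasing order, followed by zeros. -/
def decr {ι : Type*} [Fintype ι] (x : ι → ℝ) (i : ℕ) : ℝ :=
  ((Finset.univ.val.map x).sort (· ≥ ·)).getD i 0

/-- Majorization `x ≺ y` of finite vectors with nonnegative entries; vectors of different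
dimensions are compared after appending zeros. -/
def Majorized {ι κ : Type*} [Fintype ι] [Fintype κ] (x : ι → ℝ) (y : κ → ℝ) : Prop :=
  ∀ k : ℕ, ∑ i ∈ Finset.range k, decr x i ≤ ∑ i ∈ Finset.range k, decr y i

/-- The tensor power `x^{⊗n}`, with coordinates indexed by multi-indices. -/
def tensorPow {d : ℕ} (x : Fin d → ℝ) (n : ℕ) : (Fin n → Fin d) → ℝ :=
  fun a => ∏ j, x (a j)

/-- Multiple-copy majorization `x ≺_M y`. -/
def MajorizedM {e d : ℕ} (x : Fin e → ℝ) (y : Fin d → ℝ) : Prop :=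
  ∃ n : ℕ, 1 ≤ n ∧ Majorized (tensorPow x n) (tensorPow y n)

/-- The set `M_e(y)` of `e`-dimensional probability vectors `x` with `x ≺_M y`. -/
def M (e : ℕ) {d : ℕ} (y : Fin d → ℝ) : Set (Fin e → ℝ) :=
  {x | x ∈ P e ∧ MajorizedM x y}

/-- The space `ℓ¹` of real sequences, with the norm `∑ i, |x i|`. -/
abbrev L1 : Type := lp (fun _ : ℕ => ℝ) 1

/-- A `d`-dimensional vector followed by zeros, as an element of `ℓ¹`. -/
def pad {d : ℕ} (x : Fin d → ℝ) : L1 :=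
  ⟨fun i => if h : i < d then x ⟨i, h⟩ else 0,
    (memℓp_zero ((Set.finite_lt_nat d).subset fun i hi => by
      by_contra h
      exact hi (dif_neg h))).of_exponent_ge zero_le_one⟩

/-- The set `M_{<∞}(y)`, the union of the sets `M_e(y)` over all dimensions `e`. -/
def MFin {d : ℕ} (y : Fin d → ℝ) : Set L1 :=
  ⋃ e : ℕ, pad '' M e y

/-- `N_p(x)`, the sum of the `p`-th powers of the nonzero coordinates of `x`. -/
def N {d : ℕ} (p : ℝ) (x : Fin d → ℝ) : ℝ :=
  ∑ i with 0 < x i, x i ^ p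

end Catalysis

end

/-! For vectors of equal total mass, majorization amounts to `∑ (x i - t)⁺ ≤ ∑ (y i - t)⁺` for all
`t ≥ 0`. For `n`-th tensor powers at level `t = exp (n τ)` these sums are governed by large
deviations. A Chernoff bound gives at most `N p x ^ n * t ^ (1 - p)` for every `p ≥ 1`; tilting `y`
by `y ^ p`, with `p` chosen so that the tilted mean of `log y` is close to `τ`, gives the matching
lower bound up to small exponential errors (`tilted_lower_bound`). Shrinking `x` by `exp (-η)` pays
for those errors with one `n` valid for all `t > 0` (`exists_sum_max_tensorPow_le`).

The lost mass `ε` is restored by at least `d ^ n` equal tiny coordinates. They do not affect levels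
above their size, and below it convexity in `t` suffices (`majorized_append`). This is why the
dimension must grow. -/

/-! ### Majorization through truncated sums -/

open Finset in
/-- Partial sums are bounded by the dual functional `k t + ∑ (v - t)⁺`. -/
theorem Catalysis.sum_getD_le (L : List ℝ) {t : ℝ} (ht : 0 ≤ t) (k : ℕ) :
    ∑ i ∈ range k, L.getD i 0 ≤ k * t + (L.map fun v => max (v - t) 0).sum := by
  induction L generalizing k with
  | nil => simpa using by positivity
  | cons v L ih =>
    cases k with
    | zero =>
      have := ih 0
      simp only [range_zero, sum_empty, Nat.cast_zero, zero_mul, zero_add, List.map_cons,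
        List.sum_cons] at this ⊢
      positivity
    | succ k =>
      rw [sum_range_succ']
      have h₁ := ih k
      have h₂ := le_max_left (v - t) 0
      simp only [List.getD_cons_succ, List.getD_cons_zero, List.map_cons, List.sum_cons]
      push_cast
      linarith

open Finset in
/-- The dual functional attains the partial sums of a decreasing list. -/
theorem Catalysis.exists_dual_le_sum_getD (L : List ℝ) (hL : L.Pairwise (· ≥ ·))
    (h0 : ∀ v ∈ L, 0 ≤ v) (k : ℕ) :
    ∃ t : ℝ, 0 ≤ t ∧ (∀ b, 0 ≤ b → (∀ v ∈ L, v ≤ b) → t ≤ b) ∧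
      k * t + (L.map fun v => max (v - t) 0).sum ≤ ∑ i ∈ range k, L.getD i 0 := by
  induction L generalizing k with
  | nil => exact ⟨0, le_rfl, fun b hb _ => hb, by simp⟩
  | cons v L ih =>
    rw [List.pairwise_cons] at hL
    have hv : 0 ≤ v := h0 v (by simp)
    cases k with
    | zero =>
      refine ⟨v, hv, fun b _ h => h v (by simp), ?_⟩
      have : (L.map fun w => max (w - v) 0) = L.map fun _ => (0 : ℝ) :=
        List.map_congr_left fun w hw => max_eq_right (sub_nonpos.2 (hL.1 w hw))
      simp [this]
    | succ k =>
      obtain ⟨t, ht, hb, h⟩ := ih hL.2 (fun w hw => h0 w (by simp [hw])) k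
      -- The minimality clause on `t` exists for this step: the head bounds the tail, so its
      -- truncation at `t` loses nothing.
      have htv : t ≤ v := hb v hv hL.1
      refine ⟨t, ht, fun b hb0 h' => hb b hb0 fun w hw => h' w (by simp [hw]), ?_⟩
      rw [sum_range_succ']
      simp only [List.getD_cons_succ, List.getD_cons_zero, List.map_cons, List.sum_cons,
        max_eq_left (sub_nonneg.2 htv)]
      push_cast
      linarith

theorem Catalysis.sum_map_sort {ι : Type*} [Fintype ι] (x : ι → ℝ) (g : ℝ → ℝ) :
    (((Finset.univ.val.map x).sort (· ≥ ·)).map g).sum = ∑ i, g (x i) := by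
  rw [← Multiset.sum_coe, ← Multiset.map_coe, Multiset.sort_eq, Multiset.map_map]
  rfl

/-- Majorization follows from the inequalities `∑ (x i - t)⁺ ≤ ∑ (y i - t)⁺`. -/
theorem Catalysis.majorized_of_sum_max {ι κ : Type*} [Fintype ι] [Fintype κ] {x : ι → ℝ}
    {y : κ → ℝ} (hy : ∀ i, 0 ≤ y i)
    (h : ∀ t, 0 ≤ t → ∑ i, max (x i - t) 0 ≤ ∑ i, max (y i - t) 0) : Majorized x y := by
  intro k
  obtain ⟨t, ht, -, hk⟩ := exists_dual_le_sum_getD ((Finset.univ.val.map y).sort (· ≥ ·))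
    (Multiset.pairwise_sort _ _) (fun v hv => by
      rw [Multiset.mem_sort, Multiset.mem_map] at hv
      obtain ⟨i, -, rfl⟩ := hv
      exact hy i) k
  have hx := sum_getD_le ((Finset.univ.val.map x).sort (· ≥ ·)) ht k
  rw [sum_map_sort y fun v => max (v - t) 0] at hk
  rw [sum_map_sort x fun v => max (v - t) 0] at hx
  have := h t ht
  exact hx.trans (le_trans (by linarith) hk)

/-! ### Moments and Chebyshev's inequality for product weights -/

theorem Catalysis.sum_fun_succ {α : Type*} [Fintype α] (n : ℕ) (F : (Fin (n + 1) → α) → ℝ) :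
    ∑ a, F a = ∑ i, ∑ a : Fin n → α, F (Fin.cons i a) := by
  rw [← (Fin.consEquiv fun _ => α).sum_comp, Fintype.sum_prod_type]
  rfl

theorem Catalysis.sum_prod_mul_sum {α : Type*} [Fintype α] {w f : α → ℝ} (hw : ∑ i, w i = 1)
    (hf : ∑ i, w i * f i = 0) (n : ℕ) :
    ∑ a : Fin n → α, (∏ j, w (a j)) * ∑ j, f (a j) = 0 := by
  induction n with
  | zero => simp
  | succ n ih =>
    have h1 := Fintype.sum_pow w n
    rw [hw, one_pow] at h1
    simp only [sum_fun_succ, Fin.prod_univ_succ, Fin.sum_univ_succ, Fin.cons_zero, Fin.cons_succ]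
    have key : ∀ i, ∑ a : Fin n → α, (w i * ∏ j, w (a j)) * (f i + ∑ j, f (a j)) = w i * f i := by
      intro i
      calc _ = w i * f i * ∑ a : Fin n → α, ∏ j, w (a j)
            + w i * ∑ a : Fin n → α, (∏ j, w (a j)) * ∑ j, f (a j) := by
            rw [Finset.mul_sum, Finset.mul_sum, ← Finset.sum_add_distrib]
            exact Finset.sum_congr rfl fun a _ => by ring
        _ = _ := by rw [ih, ← h1]; ring
    simp only [key, hf]

/-- The variance of a sum of independent centered variables, as a finite sum. -/
theorem Catalysis.sum_prod_mul_sum_sq {α : Type*} [Fintype α] {w f : α → ℝ}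
    (hw : ∑ i, w i = 1) (hf : ∑ i, w i * f i = 0) (n : ℕ) :
    ∑ a : Fin n → α, (∏ j, w (a j)) * (∑ j, f (a j)) ^ 2 = n * ∑ i, w i * f i ^ 2 := by
  induction n with
  | zero => simp
  | succ n ih =>
    have h1 := Fintype.sum_pow w n
    rw [hw, one_pow] at h1
    simp only [sum_fun_succ, Fin.prod_univ_succ, Fin.sum_univ_succ, Fin.cons_zero, Fin.cons_succ]
    have key : ∀ i, ∑ a : Fin n → α, (w i * ∏ j, w (a j)) * (f i + ∑ j, f (a j)) ^ 2
        = w i * f i ^ 2 + w i * (n * ∑ i, w i * f i ^ 2) := by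
      intro i
      calc _ = w i * f i ^ 2 * ∑ a : Fin n → α, ∏ j, w (a j)
            + 2 * w i * f i * (∑ a : Fin n → α, (∏ j, w (a j)) * ∑ j, f (a j))
            + w i * ∑ a : Fin n → α, (∏ j, w (a j)) * (∑ j, f (a j)) ^ 2 := by
            rw [Finset.mul_sum, Finset.mul_sum, Finset.mul_sum, ← Finset.sum_add_distrib,
              ← Finset.sum_add_distrib]
            exact Finset.sum_congr rfl fun a _ => by ring
        _ = _ := by rw [ih, ← h1, sum_prod_mul_sum hw hf]; ring
    simp only [key, Finset.sum_add_distrib, ← Finset.sum_mul, hw]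
    push_cast
    ring

/-- Chebyshev's inequality for a product weight. -/
theorem Catalysis.half_le_sum_prod {α : Type*} [Fintype α] {w f : α → ℝ} (hw0 : ∀ i, 0 ≤ w i)
    (hw : ∑ i, w i = 1) (hf : ∑ i, w i * f i = 0) {C δ : ℝ} (hC : ∀ i, |f i| ≤ C) (hδ : 0 < δ)
    {n : ℕ} (hn : 0 < n) (hnC : 2 * C ^ 2 ≤ n * δ ^ 2) :
    1 / 2 ≤ ∑ a : Fin n → α with |∑ j, f (a j)| ≤ n * δ, ∏ j, w (a j) := by
  have h1 := Fintype.sum_pow w n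
  rw [hw, one_pow, ← Finset.sum_filter_add_sum_filter_not Finset.univ
    (fun a : Fin n → α => |∑ j, f (a j)| ≤ n * δ)] at h1
  have hn' : (0 : ℝ) < n := by exact_mod_cast hn
  have hW : ∀ a : Fin n → α, 0 ≤ ∏ j, w (a j) := fun a => Finset.prod_nonneg fun j _ => hw0 _
  have h2 : (n * δ) ^ 2 * ∑ a : Fin n → α with ¬ |∑ j, f (a j)| ≤ n * δ, ∏ j, w (a j)
      ≤ n * C ^ 2 := by
    calc _ ≤ ∑ a : Fin n → α with ¬ |∑ j, f (a j)| ≤ n * δ,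
          (∏ j, w (a j)) * (∑ j, f (a j)) ^ 2 := by
          rw [Finset.mul_sum]
          refine Finset.sum_le_sum fun a ha => ?_
          have ha' := (not_le.1 (Finset.mem_filter.1 ha).2).le
          rw [mul_comm, ← sq_abs (∑ j, f (a j))]
          exact mul_le_mul_of_nonneg_left (pow_le_pow_left₀ (by positivity) ha' 2) (hW a)
      _ ≤ ∑ a : Fin n → α, (∏ j, w (a j)) * (∑ j, f (a j)) ^ 2 :=
          Finset.sum_le_sum_of_subset_of_nonneg (Finset.filter_subset _ _)
            fun a _ _ => mul_nonneg (hW a) (sq_nonneg _)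
      _ = n * ∑ i, w i * f i ^ 2 := sum_prod_mul_sum_sq hw hf n
      _ ≤ n * ∑ i, w i * C ^ 2 := by
          refine mul_le_mul_of_nonneg_left (Finset.sum_le_sum fun i _ => ?_) hn'.le
          rw [← sq_abs (f i)]
          exact mul_le_mul_of_nonneg_left (pow_le_pow_left₀ (abs_nonneg _) (hC i) 2) (hw0 i)
      _ = n * C ^ 2 := by rw [← Finset.sum_mul, hw, one_mul]
  have h3 : (n * δ) ^ 2 * ∑ a : Fin n → α with ¬ |∑ j, f (a j)| ≤ n * δ, ∏ j, w (a j)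
      ≤ (n * δ) ^ 2 * (1 / 2) := by nlinarith
  have := le_of_mul_le_mul_left h3 (by positivity)
  linarith

/-! ### Exponential tilting -/

/-- The mean of `log y` under the weights proportional to `y ^ p`. -/
noncomputable def Catalysis.tiltedMean {d : ℕ} (y : Fin d → ℝ) (p : ℝ) : ℝ :=
  (∑ i, y i ^ p * Real.log (y i)) / ∑ i, y i ^ p

theorem Catalysis.N_eq_sum {d : ℕ} {p : ℝ} (hp : 1 ≤ p) {x : Fin d → ℝ} (hx : ∀ i, 0 ≤ x i) :
    N p x = ∑ i, x i ^ p := by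
  unfold N
  rw [Finset.sum_filter]
  refine Finset.sum_congr rfl fun i _ => ?_
  split_ifs with h
  · rfl
  · rw [le_antisymm (not_lt.1 h) (hx i), Real.zero_rpow (by linarith)]

theorem Catalysis.sum_rpow_pos {d : ℕ} {y : Fin d → ℝ} (hy : ∀ i, 0 ≤ y i) {i₀ : Fin d}
    (h : 0 < y i₀) (p : ℝ) : 0 < ∑ i, y i ^ p :=
  Finset.sum_pos' (fun i _ => Real.rpow_nonneg (hy i) p)
    ⟨i₀, Finset.mem_univ _, Real.rpow_pos_of_pos h p⟩

/-- The lower bound for `∑ (y^{⊗n} - t)⁺` obtained by tilting. -/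
theorem Catalysis.tilted_lower_bound {d : ℕ} {y : Fin d → ℝ} (hy : ∀ i, 0 ≤ y i) {i₀ : Fin d}
    (hi₀ : 0 < y i₀) {p : ℝ} (hp : 1 ≤ p) {C δ t : ℝ}
    (hC : ∀ i, |Real.log (y i) - tiltedMean y p| ≤ C) (hδ : 0 < δ) {n : ℕ} (hn : 0 < n)
    (hnC : 2 * C ^ 2 ≤ n * δ ^ 2) (hn2 : 2 ≤ Real.exp (n * δ))
    (ht : t ≤ Real.exp (n * (tiltedMean y p - 2 * δ))) :
    1 / 4 * (∑ i, y i ^ p) ^ n * Real.exp (n * (1 - p) * (tiltedMean y p + δ))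
      ≤ ∑ a, max (tensorPow y n a - t) 0 := by
  set q := ∑ i, y i ^ p with hq
  set m := tiltedMean y p with hm
  have hq0 : 0 < q := sum_rpow_pos hy hi₀ p
  have hw : ∑ i, y i ^ p / q = 1 := by rw [← Finset.sum_div, div_self hq0.ne']
  have hf : ∑ i, y i ^ p / q * (Real.log (y i) - m) = 0 := by
    simp only [mul_sub, Finset.sum_sub_distrib, ← Finset.sum_mul, hw, one_mul]
    rw [hm, tiltedMean, Finset.sum_div, sub_eq_zero]
    exact Finset.sum_congr rfl fun i _ => by rw [div_mul_eq_mul_div]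
  have hcheb := half_le_sum_prod (fun i => div_nonneg (Real.rpow_nonneg (hy i) p) hq0.le) hw hf hC
    hδ hn hnC
  set E := Real.exp (n * (1 - p) * (m + δ)) with hE
  have hterm : ∀ a ∈ Finset.univ.filter
      (fun a : Fin n → Fin d => |∑ j, (Real.log (y (a j)) - m)| ≤ n * δ),
      1 / 2 * q ^ n * E * (∏ j, y (a j) ^ p / q) ≤ max (tensorPow y n a - t) 0 := by
    intro a ha
    have ha := (Finset.mem_filter.1 ha).2
    -- Since `Real.log 0 = 0`, multi-indices meeting a zero of `y` may pass the filter, but their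
    -- tilted weight is zero.
    by_cases hz : ∃ j, y (a j) = 0
    · obtain ⟨j, hj⟩ := hz
      rw [Finset.prod_eq_zero (Finset.mem_univ j) (by
        rw [hj, Real.zero_rpow (by linarith), zero_div]), mul_zero]
      exact le_max_right _ _
    push Not at hz
    have hpos : ∀ j, 0 < y (a j) := fun j => lt_of_le_of_ne (hy _) (hz j).symm
    set S := ∑ j, Real.log (y (a j)) with hS
    have hSm : |S - n * m| ≤ n * δ := by
      rwa [Finset.sum_sub_distrib, Finset.sum_const, Finset.card_univ, Fintype.card_fin,
        nsmul_eq_mul] at ha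
    rw [abs_le] at hSm
    have hprod : tensorPow y n a = Real.exp S := by
      rw [hS, Real.exp_sum, tensorPow]
      exact Finset.prod_congr rfl fun j _ => (Real.exp_log (hpos j)).symm
    have hW : q ^ n * ∏ j, y (a j) ^ p / q = Real.exp (p * S) := by
      rw [Finset.prod_div_distrib, Finset.prod_const, Finset.card_univ, Fintype.card_fin,
        mul_div_cancel₀ _ (by positivity), hS, Finset.mul_sum, Real.exp_sum]
      exact Finset.prod_congr rfl fun j _ => by
        rw [Real.rpow_def_of_pos (hpos j), mul_comm]
    -- Of the margin `2 * δ`, one `δ` covers the fluctuation of `S` and the other yields the factor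
    -- 2, so subtracting `t` costs at most half.
    have ht2 : 2 * t ≤ Real.exp S := by
      calc 2 * t ≤ 2 * Real.exp (n * (m - 2 * δ)) := by linarith
        _ ≤ Real.exp (n * δ) * Real.exp (n * (m - 2 * δ)) := by gcongr
        _ = Real.exp (n * (m - δ)) := by rw [← Real.exp_add]; ring_nf
        _ ≤ Real.exp S := Real.exp_le_exp.2 (by linarith)
    have hEb : E * Real.exp (p * S) ≤ Real.exp S := by
      rw [hE, ← Real.exp_add, Real.exp_le_exp]
      nlinarith
    calc _ = 1 / 2 * (E * (q ^ n * ∏ j, y (a j) ^ p / q)) := by ring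
      _ ≤ tensorPow y n a - t := by rw [hW, hprod]; linarith
      _ ≤ _ := le_max_left _ _
  calc 1 / 4 * q ^ n * E = 1 / 2 * q ^ n * E * (1 / 2) := by ring
    _ ≤ 1 / 2 * q ^ n * E * ∑ a : Fin n → Fin d with |∑ j, (Real.log (y (a j)) - m)| ≤ n * δ,
          ∏ j, y (a j) ^ p / q := by gcongr
    _ ≤ ∑ a : Fin n → Fin d with |∑ j, (Real.log (y (a j)) - m)| ≤ n * δ,
          max (tensorPow y n a - t) 0 := by
        rw [Finset.mul_sum]; exact Finset.sum_le_sum hterm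
    _ ≤ _ := Finset.sum_le_sum_of_subset_of_nonneg (Finset.filter_subset _ _)
            fun a _ _ => le_max_right _ _

theorem Catalysis.abs_tiltedMean_le {d : ℕ} {y : Fin d → ℝ} (hy : ∀ i, 0 ≤ y i) {i₀ : Fin d}
    (hi₀ : 0 < y i₀) {L : ℝ} (hL : ∀ i, |Real.log (y i)| ≤ L) (p : ℝ) : |tiltedMean y p| ≤ L := by
  have hq0 := sum_rpow_pos hy hi₀ p
  rw [tiltedMean, abs_div, abs_of_pos hq0, div_le_iff₀ hq0]
  refine (Finset.abs_sum_le_sum_abs _ _).trans ?_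
  rw [Finset.mul_sum]
  refine Finset.sum_le_sum fun i _ => ?_
  rw [abs_mul, abs_of_nonneg (Real.rpow_nonneg (hy i) p), mul_comm]
  exact mul_le_mul_of_nonneg_right (hL i) (Real.rpow_nonneg (hy i) p)

/-- The domain stays away from `p = 0`, where `0 ^ p` jumps. -/
theorem Catalysis.continuousOn_tiltedMean {d : ℕ} {y : Fin d → ℝ} (hy : ∀ i, 0 ≤ y i)
    {i₀ : Fin d} (hi₀ : 0 < y i₀) : ContinuousOn (tiltedMean y) (Set.Ici 1) := by
  have hc : ∀ i, ContinuousOn (fun p : ℝ => y i ^ p) (Set.Ici 1) := fun i p hp =>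
    (Real.continuousAt_const_rpow' (by
      have : (1 : ℝ) ≤ p := hp
      linarith)).continuousWithinAt
  exact (continuousOn_finsetSum _ fun i _ => (hc i).mul continuousOn_const).div
    (continuousOn_finsetSum _ fun i _ => hc i) fun p _ => (sum_rpow_pos hy hi₀ p).ne'

theorem Catalysis.tendsto_rpow_mul_log {r : ℝ} (h0 : 0 ≤ r) (h1 : r ≤ 1) :
    Tendsto (fun p : ℝ => r ^ p * Real.log r) atTop (𝓝 0) := by
  rcases h1.eq_or_lt with rfl | h1
  · simp
  · simpa using (tendsto_rpow_atTop_of_base_lt_one r (by linarith) h1).mul_const (Real.log r)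

/-- The difference from the limit is the mean of `log (y i / y i₀)` under weights `(y i / y i₀) ^
p`: the total weight is at least 1, and each term of the numerator tends to 0. -/
theorem Catalysis.tendsto_tiltedMean {d : ℕ} {y : Fin d → ℝ} (hy : ∀ i, 0 ≤ y i)
    {i₀ : Fin d} (hi₀ : 0 < y i₀) (hmax : ∀ i, y i ≤ y i₀) :
    Tendsto (tiltedMean y) atTop (𝓝 (Real.log (y i₀))) := by
  have hr0 : ∀ i, 0 ≤ y i / y i₀ := fun i => div_nonneg (hy i) hi₀.le
  have hr1 : ∀ i, y i / y i₀ ≤ 1 := fun i => (div_le_one hi₀).2 (hmax i)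
  have hnum : Tendsto (fun p : ℝ => |∑ i, (y i / y i₀) ^ p * Real.log (y i / y i₀)|) atTop
      (𝓝 0) := by
    have := tendsto_finsetSum Finset.univ fun i _ => tendsto_rpow_mul_log (hr0 i) (hr1 i)
    simpa using this.abs
  rw [tendsto_iff_norm_sub_tendsto_zero]
  refine squeeze_zero' (Eventually.of_forall fun _ => norm_nonneg _) ?_ hnum
  filter_upwards [eventually_ge_atTop 1] with p hp
  have hk : 0 < y i₀ ^ p := Real.rpow_pos_of_pos hi₀ p
  have hq0 := sum_rpow_pos hy hi₀ p
  have hD : (∑ i, (y i / y i₀) ^ p) = (∑ i, y i ^ p) / y i₀ ^ p := by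
    rw [Finset.sum_div]
    exact Finset.sum_congr rfl fun i _ => Real.div_rpow (hy i) hi₀.le p
  have h1 : 1 ≤ ∑ i, (y i / y i₀) ^ p := by
    rw [hD, one_le_div hk]
    exact Finset.single_le_sum (f := fun i => y i ^ p)
      (fun i _ => Real.rpow_nonneg (hy i) p) (Finset.mem_univ i₀)
  have heq : tiltedMean y p - Real.log (y i₀)
      = (∑ i, (y i / y i₀) ^ p * Real.log (y i / y i₀)) / ∑ i, (y i / y i₀) ^ p := by
    rw [eq_div_iff (by linarith), hD, tiltedMean, sub_mul, div_mul_div_comm,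
      mul_div_mul_comm, div_mul_div_comm, ← sub_eq_zero]
    have : ∀ i, (y i / y i₀) ^ p * Real.log (y i / y i₀)
        = (y i ^ p * Real.log (y i) - Real.log (y i₀) * y i ^ p) / y i₀ ^ p := by
      intro i
      rcases (hy i).eq_or_lt with h | h
      · simp [← h, Real.zero_rpow (by linarith : p ≠ 0)]
      · rw [Real.div_rpow h.le hi₀.le, Real.log_div h.ne' hi₀.ne']; ring
    simp only [this]
    rw [← Finset.sum_div, Finset.sum_sub_distrib, ← Finset.mul_sum]
    field_simp
    ring
  rw [heq, Real.norm_eq_abs, abs_div, abs_of_pos (by linarith : 0 < ∑ i, (y i / y i₀) ^ p)]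
  exact div_le_self (abs_nonneg _) h1

/-- Every level below `log (max y)` is a tilted mean, unless it lies below the mean at `p = 1`. -/
theorem Catalysis.exists_tiltedMean {d : ℕ} {y : Fin d → ℝ} (hy : ∀ i, 0 ≤ y i)
    {i₀ : Fin d} (hi₀ : 0 < y i₀) (hmax : ∀ i, y i ≤ y i₀) {c : ℝ} (hc : c < Real.log (y i₀)) :
    ∃ p : ℝ, 1 ≤ p ∧ c ≤ tiltedMean y p ∧ (p = 1 ∨ tiltedMean y p = c) := by
  rcases le_total c (tiltedMean y 1) with h | h
  -- At `p = 1` the factors with exponent `1 - p` are trivial, so the mean need not equal `c`.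
  · exact ⟨1, le_rfl, h, Or.inl rfl⟩
  obtain ⟨b, hb, hb1⟩ := (((tendsto_tiltedMean hy hi₀ hmax).eventually (lt_mem_nhds hc)).and
    (eventually_ge_atTop 1)).exists
  obtain ⟨p, hp, hpc⟩ := intermediate_value_Icc hb1
    ((continuousOn_tiltedMean hy hi₀).mono Set.Icc_subset_Ici_self) ⟨h, hb.le⟩
  exact ⟨p, hp.1, hpc.ge, Or.inr hpc⟩

/-! ### Comparison of tensor powers -/

/-- The Chernoff-type upper bound for `∑ (a^{⊗n} - t)⁺`. -/
theorem Catalysis.sum_max_tensorPow_le {d : ℕ} {a : Fin d → ℝ} (ha : ∀ i, 0 ≤ a i) {p t : ℝ}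
    (hp : 1 ≤ p) (ht : 0 < t) (n : ℕ) :
    ∑ b, max (tensorPow a n b - t) 0 ≤ (∑ i, a i ^ p) ^ n * t ^ (1 - p) := by
  rw [Fintype.sum_pow, Finset.sum_mul]
  refine Finset.sum_le_sum fun b _ => ?_
  rw [Real.finsetProd_rpow _ _ fun j _ => ha _]
  change max (tensorPow a n b - t) 0 ≤ tensorPow a n b ^ p * t ^ (1 - p)
  have hA : 0 ≤ tensorPow a n b := Finset.prod_nonneg fun j _ => ha _
  refine max_le ?_ (by positivity)
  rcases le_total (tensorPow a n b) t with h | h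
  · exact (sub_nonpos.2 h).trans (by positivity)
  have hA' : 0 < tensorPow a n b := ht.trans_le h
  calc tensorPow a n b - t ≤ tensorPow a n b := by linarith
    _ = tensorPow a n b ^ p * tensorPow a n b ^ (1 - p) := by
        rw [← Real.rpow_add hA', add_sub_cancel, Real.rpow_one]
    _ ≤ _ := by
        gcongr ?_ * ?_
        exact Real.rpow_le_rpow_of_nonpos ht h (by linarith)

/-- As `p` grows the power sums detect the maximum: a strictly larger ratio, raised to a high power,
beats the factor `d`. -/
theorem Catalysis.le_max_of_sum_rpow_le {d : ℕ} {x y : Fin d → ℝ} (hx : ∀ i, 0 ≤ x i)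
    (hy : ∀ i, 0 ≤ y i) (hN : ∀ p : ℝ, 1 ≤ p → ∑ i, x i ^ p ≤ ∑ i, y i ^ p) {i₀ : Fin d}
    (hi₀ : 0 < y i₀) (hmax : ∀ i, y i ≤ y i₀) (i : Fin d) : x i ≤ y i₀ := by
  by_contra! h
  have hr : 1 < x i / y i₀ := (one_lt_div hi₀).2 h
  obtain ⟨k, hk⟩ := pow_unbounded_of_one_lt (d : ℝ) hr
  have hk' : (d : ℝ) < (x i / y i₀) ^ (k + 1) :=
    hk.trans_le (pow_le_pow_right₀ hr.le k.le_succ)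
  have h1 := hN ((k + 1 : ℕ) : ℝ) (by push_cast; linarith [k.cast_nonneg (α := ℝ)])
  simp only [Real.rpow_natCast] at h1
  have h2 : x i ^ (k + 1) ≤ ∑ i, x i ^ (k + 1) :=
    Finset.single_le_sum (f := fun i => x i ^ (k + 1)) (fun j _ => pow_nonneg (hx j) _)
      (Finset.mem_univ i)
  have h3 : ∑ i, y i ^ (k + 1) ≤ ∑ _i : Fin d, y i₀ ^ (k + 1) :=
    Finset.sum_le_sum fun j _ => pow_le_pow_left₀ (hy j) (hmax j) _
  rw [Finset.sum_const, Finset.card_univ, Fintype.card_fin, nsmul_eq_mul] at h3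
  rw [div_pow, lt_div_iff₀ (by positivity)] at hk'
  linarith

/-- After shrinking `x` by a factor less than one, high tensor powers are submajorized. -/
theorem Catalysis.exists_sum_max_tensorPow_le {d : ℕ} {x y : Fin d → ℝ} (hx : ∀ i, 0 ≤ x i)
    (hy : ∀ i, 0 ≤ y i) (hN : ∀ p : ℝ, 1 ≤ p → ∑ i, x i ^ p ≤ ∑ i, y i ^ p) {i₀ : Fin d}
    (hi₀ : 0 < y i₀) (hmax : ∀ i, y i ≤ y i₀) {η : ℝ} (hη : 0 < η) :
    ∃ n : ℕ, 0 < n ∧ ∀ t : ℝ, 0 < t →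
      ∑ b, max (tensorPow (fun i => Real.exp (-η) * x i) n b - t) 0
        ≤ ∑ b, max (tensorPow y n b - t) 0 := by
  obtain ⟨L, hL⟩ : ∃ L, ∀ i, |Real.log (y i)| ≤ L :=
    ⟨∑ i, |Real.log (y i)|, fun i => Finset.single_le_sum (f := fun i => |Real.log (y i)|)
      (fun _ _ => abs_nonneg _) (Finset.mem_univ i)⟩
  set δ := η / 3 with hδ
  have hδ0 : 0 < δ := by positivity
  -- The bound `2 * L` on the centered logarithms holds for every `p`, so `n` can be fixed before
  -- `t`.
  obtain ⟨n, hn, hn1, hn2, hn3⟩ : ∃ n : ℕ, 0 < n ∧ 2 * (2 * L) ^ 2 ≤ n * δ ^ 2 ∧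
      2 ≤ Real.exp (n * δ) ∧ 4 ≤ Real.exp (n * η) := by
    have hlin : ∀ c : ℝ, 0 < c → Tendsto (fun n : ℕ => (n : ℝ) * c) atTop atTop := fun c hc =>
      tendsto_natCast_atTop_atTop.atTop_mul_const hc
    exact ((eventually_gt_atTop 0).and (((hlin _ (by positivity)).eventually_ge_atTop _).and
      (((Real.tendsto_exp_atTop.comp (hlin δ hδ0)).eventually_ge_atTop 2).and
      ((Real.tendsto_exp_atTop.comp (hlin η hη)).eventually_ge_atTop 4)))).exists
  refine ⟨n, hn, fun t ht => ?_⟩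
  have hn' : (0 : ℝ) < n := by exact_mod_cast hn
  have ha : ∀ i, 0 ≤ Real.exp (-η) * x i := fun i => mul_nonneg (Real.exp_pos _).le (hx i)
  obtain ⟨τ, hτ⟩ : ∃ τ, t = Real.exp (n * τ) :=
    ⟨Real.log t / n, by rw [mul_div_cancel₀ _ hn'.ne', Real.exp_log ht]⟩
  -- Near or above the top level, shrinking by `η = 3 * δ` puts every product on the left below `t`.
  rcases le_or_gt (Real.log (y i₀)) (τ + 2 * δ) with hc | hc
  · refine (Finset.sum_nonpos fun b _ => ?_).trans
      (Finset.sum_nonneg fun b _ => le_max_right _ _)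
    refine max_le (sub_nonpos.2 ?_) le_rfl
    calc tensorPow (fun i => Real.exp (-η) * x i) n b
        ≤ ∏ _j : Fin n, Real.exp (-η) * y i₀ :=
          Finset.prod_le_prod (fun j _ => ha _) fun j _ =>
            mul_le_mul_of_nonneg_left (le_max_of_sum_rpow_le hx hy hN hi₀ hmax _)
              (Real.exp_pos _).le
      _ = Real.exp (n * (-η + Real.log (y i₀))) := by
          rw [Finset.prod_const, Finset.card_univ, Fintype.card_fin, Real.exp_nat_mul,
            Real.exp_add, Real.exp_log hi₀]
      _ ≤ t := by
          rw [hτ, Real.exp_le_exp]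
          exact mul_le_mul_of_nonneg_left (by linarith) hn'.le
  obtain ⟨p, hp, hcp, hpc⟩ := exists_tiltedMean hy hi₀ hmax hc
  set m := tiltedMean y p with hm
  have hC : ∀ i, |Real.log (y i) - m| ≤ 2 * L := fun i => by
    have h1 := hL i
    have h2 := abs_tiltedMean_le hy hi₀ hL p
    rw [abs_le] at h1 h2 ⊢
    constructor <;> linarith [h1.1, h1.2, h2.1, h2.2]
  have hlow := tilted_lower_bound hy hi₀ hp hC hδ0 hn hn1 hn2 (t := t) (by
    rw [hτ, Real.exp_le_exp]
    exact mul_le_mul_of_nonneg_left (by linarith) hn'.le)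
  refine (sum_max_tensorPow_le ha hp ht n).trans (le_trans ?_ hlow)
  have hq : ∑ i, (Real.exp (-η) * x i) ^ p ≤ Real.exp (-η * p) * ∑ i, y i ^ p := by
    have : ∀ i, (Real.exp (-η) * x i) ^ p = Real.exp (-η * p) * x i ^ p := fun i => by
      rw [Real.mul_rpow (Real.exp_pos _).le (hx i), Real.exp_mul]
    simp only [this, ← Finset.mul_sum]
    exact mul_le_mul_of_nonneg_left (hN p hp) (Real.exp_pos _).le
  have hq0 := sum_rpow_pos hy hi₀ p
  have hexp : Real.exp (n * (-η * p)) * t ^ (1 - p)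
      ≤ 1 / 4 * Real.exp (n * (1 - p) * (m + δ)) := by
    have h4 : Real.exp (-(n * η)) ≤ 1 / 4 := by
      rw [Real.exp_neg, one_div]
      exact inv_anti₀ (by norm_num) hn3
    -- With `m = τ + 2 * δ` and `3 * δ = η`, the surplus is exactly `exp (-(n * η))`, whatever `p`
    -- is.
    calc _ = Real.exp (-(n * η)) * Real.exp (n * (1 - p) * (m + δ)) := by
          rw [hτ, ← Real.exp_mul, ← Real.exp_add, ← Real.exp_add]
          congr 1
          rcases hpc with rfl | hpc
          · ring
          · rw [hpc, hδ]; ring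
      _ ≤ _ := by gcongr
  calc (∑ i, (Real.exp (-η) * x i) ^ p) ^ n * t ^ (1 - p)
      ≤ (Real.exp (-η * p) * ∑ i, y i ^ p) ^ n * t ^ (1 - p) := by
        gcongr
        exact Finset.sum_nonneg fun i _ => Real.rpow_nonneg (ha i) p
    _ = (∑ i, y i ^ p) ^ n * (Real.exp (n * (-η * p)) * t ^ (1 - p)) := by
        rw [mul_pow, Real.exp_nat_mul]; ring
    _ ≤ (∑ i, y i ^ p) ^ n * (1 / 4 * Real.exp (n * (1 - p) * (m + δ))) := by gcongr
    _ = _ := by ring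

/-! ### Restoring the lost mass -/

theorem Catalysis.sum_tensorPow {d : ℕ} (x : Fin d → ℝ) (n : ℕ) :
    ∑ b, tensorPow x n b = (∑ i, x i) ^ n :=
  (Fintype.sum_pow x n).symm

/-- The convex function `t ↦ (z - t)⁺` lies below its chord on `[0, s]`. -/
theorem Catalysis.max_sub_le_interpolate {z s t : ℝ} (hz : 0 ≤ z) (hs : 0 < s) (ht : 0 ≤ t)
    (hts : t ≤ s) : max (z - t) 0 ≤ (1 - t / s) * z + t / s * max (z - s) 0 := by
  have h0 : 0 ≤ t / s := by positivity
  have h1 : t / s ≤ 1 := (div_le_one hs).2 hts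
  have h2 : t / s * s = t := div_mul_cancel₀ _ hs.ne'
  have h3 := le_max_left (z - s) 0
  have h4 := le_max_right (z - s) 0
  refine max_le ?_ (add_nonneg (mul_nonneg (by linarith) hz) (mul_nonneg h0 h4))
  nlinarith

/-- Filling up a subprobability vector by many small equal coordinates turns submajorization of
tensor powers into majorization. -/
theorem Catalysis.majorized_append {d : ℕ} {a y : Fin d → ℝ} {ε : ℝ} (hε : 0 < ε)
    (ha : ∀ i, 0 ≤ a i) (hasum : ∑ i, a i = 1 - ε) (hy : y ∈ P d) {n : ℕ} (hn : 0 < n)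
    (h : ∀ t : ℝ, 0 < t → ∑ b, max (tensorPow a n b - t) 0 ≤ ∑ b, max (tensorPow y n b - t) 0)
    {D : ℕ} (hD0 : 0 < D) (hD : d ^ n ≤ D) :
    Majorized (tensorPow (Fin.append a fun _ : Fin D => ε / D) n) (tensorPow y n) := by
  have hD' : (0 : ℝ) < D := by exact_mod_cast hD0
  set s := ε / D with hs
  have hs0 : 0 < s := by positivity
  set z : Fin (d + D) → ℝ := Fin.append a fun _ => s with hz
  have hz0 : ∀ i, 0 ≤ z i := fun i => by
    refine Fin.addCases (fun i => ?_) (fun i => ?_) i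
    · simpa [hz] using ha i
    · simpa [hz] using hs0.le
  have hzsum : ∑ i, z i = 1 := by
    rw [Fin.sum_univ_add]
    simp only [hz, Fin.append_left, Fin.append_right, hasum, Finset.sum_const, Finset.card_univ,
      Fintype.card_fin, nsmul_eq_mul, hs]
    rw [mul_div_cancel₀ _ hD'.ne']; ring
  have hz1 : ∀ i, z i ≤ 1 := fun i => hzsum ▸
    Finset.single_le_sum (f := z) (fun j _ => hz0 j) (Finset.mem_univ i)
  have hT0 : ∀ b, 0 ≤ tensorPow z n b := fun b => Finset.prod_nonneg fun j _ => hz0 _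
  have hlarge : ∀ t, s ≤ t →
      ∑ b, max (tensorPow z n b - t) 0 = ∑ b, max (tensorPow a n b - t) 0 := by
    intro t ht
    symm
    refine Fintype.sum_of_injective (fun (b : Fin n → Fin d) j => Fin.castAdd D (b j)) ?_ _ _ ?_ ?_
    · intro b c hbc
      funext j
      exact Fin.castAdd_injective d D (congrFun hbc j)
    · intro b hb
      obtain ⟨j, k, hk⟩ : ∃ j k, b j = Fin.natAdd d k := by
        by_contra! hcon
        have : ∀ j, ∃ i, Fin.castAdd D i = b j := fun j => by
          have := hcon j
          revert this
          refine Fin.addCases (fun i _ => ⟨i, rfl⟩) (fun i hi => (hi i rfl).elim) (b j)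
        choose c hc using this
        exact hb ⟨c, funext hc⟩
      -- A product using an appended coordinate has one factor `s` and the others at most 1.
      refine max_eq_right (sub_nonpos.2 (le_trans ?_ ht))
      rw [tensorPow, ← Finset.mul_prod_erase _ _ (Finset.mem_univ j)]
      have : z (b j) = s := by rw [hk, hz, Fin.append_right]
      rw [this]
      exact mul_le_of_le_one_right hs0.le
        (Finset.prod_le_one (fun i _ => hz0 _) fun i _ => hz1 _)
    · intro b
      simp [tensorPow, hz]
  refine majorized_of_sum_max (fun b => Finset.prod_nonneg fun j _ => hy.1 _) fun t ht => ?_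
  rcases le_total s t with hst | hts
  · rw [hlarge t hst]
    exact h t (hs0.trans_le hst)
  have hε1 : 0 ≤ 1 - ε := hasum ▸ Finset.sum_nonneg fun i _ => ha i
  have hsmall : ∑ b, max (tensorPow z n b - s) 0 ≤ 1 - ε := by
    rw [hlarge s le_rfl]
    calc _ ≤ ∑ b, tensorPow a n b := Finset.sum_le_sum fun b _ =>
          max_le (by linarith) (Finset.prod_nonneg fun j _ => ha _)
      _ = (1 - ε) ^ n := by rw [sum_tensorPow, hasum]
      _ ≤ 1 - ε := pow_le_of_le_one hε1 (by linarith) hn.ne'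
  have hts0 : 0 ≤ t / s := by positivity
  -- The chord drops from 1 with slope at most `-D`, while the sum for `y` stays above `1 - d ^ n *
  -- t`.
  calc _ ≤ ∑ b, ((1 - t / s) * tensorPow z n b + t / s * max (tensorPow z n b - s) 0) :=
        Finset.sum_le_sum fun b _ => max_sub_le_interpolate (hT0 b) hs0 ht hts
    _ = (1 - t / s) + t / s * ∑ b, max (tensorPow z n b - s) 0 := by
        rw [Finset.sum_add_distrib, ← Finset.mul_sum, ← Finset.mul_sum, sum_tensorPow, hzsum,
          one_pow, mul_one]
    _ ≤ (1 - t / s) + t / s * (1 - ε) := by gcongr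
    _ = 1 - D * t := by rw [hs]; field_simp; ring
    _ ≤ 1 - (d ^ n : ℕ) * t := by gcongr
    _ = ∑ b, (tensorPow y n b - t) := by
        rw [Finset.sum_sub_distrib, sum_tensorPow, hy.2, one_pow, Finset.sum_const,
          Finset.card_univ, Fintype.card_fun, Fintype.card_fin, Fintype.card_fin, nsmul_eq_mul]
    _ ≤ _ := Finset.sum_le_sum fun b _ => le_max_left _ _

/-! ### Approximation in `ℓ¹` -/

theorem Catalysis.norm_pad_append_sub {d D : ℕ} (a x : Fin d → ℝ) (b : Fin D → ℝ) :
    ‖pad (Fin.append a b) - pad x‖ = ∑ i, |a i - x i| + ∑ i, |b i| := by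
  rw [lp.norm_eq_tsum_rpow (by norm_num)]
  simp only [ENNReal.toReal_one, Real.rpow_one, div_one, Real.norm_eq_abs]
  rw [tsum_eq_sum (s := Finset.range (d + D))]
  · rw [Finset.sum_range, Fin.sum_univ_add]
    congr 1
    · refine Finset.sum_congr rfl fun i _ => ?_
      have : (i : ℕ) < d + D := by omega
      simp only [lp.coeFn_sub, Pi.sub_apply, pad, Fin.val_castAdd, this, i.2, dif_pos]
      congr 2
      exact Fin.append_left a b i
    · refine Finset.sum_congr rfl fun i _ => ?_
      have : d + (i : ℕ) < d + D := by omega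
      simp only [lp.coeFn_sub, Pi.sub_apply, pad, Fin.val_natAdd, this, dif_pos]
      rw [dif_neg (by omega), sub_zero]
      congr 1
      exact Fin.append_right a b i
  · intro i hi
    rw [Finset.mem_range] at hi
    simp only [lp.coeFn_sub, Pi.sub_apply, pad]
    rw [dif_neg hi, dif_neg (by omega), sub_zero, abs_zero]

/-- Shrinking by `1 - ε` and appending mass `ε` each contribute `ε` to the distance. -/
theorem Catalysis.exists_mem_MFin_near {d : ℕ} {x y : Fin d → ℝ} (hx : x ∈ P d) (hy : y ∈ P d)
    (hN : ∀ p : ℝ, 1 ≤ p → N p x ≤ N p y) {ε : ℝ} (hε : 0 < ε) (hε1 : ε < 1) :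
    ∃ u ∈ MFin y, ‖u - pad x‖ ≤ 2 * ε := by
  have hN' : ∀ p : ℝ, 1 ≤ p → ∑ i, x i ^ p ≤ ∑ i, y i ^ p := fun p hp => by
    rw [← N_eq_sum hp hx.1, ← N_eq_sum hp hy.1]
    exact hN p hp
  have hd : 0 < d := by
    rcases Nat.eq_zero_or_pos d with rfl | h
    · simpa using hy.2
    · exact h
  have : Nonempty (Fin d) := ⟨⟨0, hd⟩⟩
  obtain ⟨i₀, hmax⟩ := Finite.exists_max y
  have hi₀ : 0 < y i₀ := by
    by_contra! h
    have := hy.2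
    rw [Finset.sum_eq_zero fun i _ => le_antisymm ((hmax i).trans h) (hy.1 i)] at this
    exact zero_ne_one this
  have he : Real.exp (-(-Real.log (1 - ε))) = 1 - ε := by
    rw [neg_neg, Real.exp_log (by linarith)]
  obtain ⟨n, hn, h⟩ := exists_sum_max_tensorPow_le hx.1 hy.1 hN' hi₀ hmax
    (η := -Real.log (1 - ε)) (neg_pos.2 (Real.log_neg (by linarith) (by linarith)))
  rw [he] at h
  have ha : ∀ i, 0 ≤ (1 - ε) * x i := fun i => mul_nonneg (by linarith) (hx.1 i)
  have hasum : ∑ i, (1 - ε) * x i = 1 - ε := by rw [← Finset.mul_sum, hx.2, mul_one]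
  have hD : 0 < d ^ n := pow_pos hd n
  have hD' : (0 : ℝ) < (d ^ n : ℕ) := by exact_mod_cast hD
  have hb : ∑ _i : Fin (d ^ n), ε / (d ^ n : ℕ) = ε := by
    rw [Finset.sum_const, Finset.card_univ, Fintype.card_fin, nsmul_eq_mul,
      mul_div_cancel₀ _ hD'.ne']
  refine ⟨pad (Fin.append (fun i => (1 - ε) * x i) fun _ : Fin (d ^ n) => ε / (d ^ n : ℕ)),
    Set.mem_iUnion.2 ⟨d + d ^ n, _, ⟨⟨fun i => ?_, ?_⟩, n, hn,
      majorized_append hε ha hasum hy hn h hD le_rfl⟩, rfl⟩, ?_⟩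
  · refine Fin.addCases (fun i => ?_) (fun i => ?_) i
    · rw [Fin.append_left]; exact ha i
    · rw [Fin.append_right]; positivity
  · rw [Fin.sum_univ_add]
    simp only [Fin.append_left, Fin.append_right]
    rw [hasum, hb]; ring
  · rw [norm_pad_append_sub]
    have h1 : ∑ i, |(1 - ε) * x i - x i| = ε := by
      calc _ = ∑ i, ε * x i := Finset.sum_congr rfl fun i _ => by
            rw [show (1 - ε) * x i - x i = -(ε * x i) by ring, abs_neg,
              abs_of_nonneg (mul_nonneg hε.le (hx.1 i))]
        _ = ε := by rw [← Finset.mul_sum, hx.2, mul_one]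
    rw [h1]
    simp only [abs_of_pos (div_pos hε hD')]
    rw [hb]; linarith

theorem mainTheorem3 (d : ℕ) (x y : Fin d → ℝ) (hx : x ∈ Catalysis.P d) (hy : y ∈ Catalysis.P d)
    (hN : ∀ p : ℝ, 1 ≤ p → Catalysis.N p x ≤ Catalysis.N p y) :
    ∃ u : ℕ → Catalysis.L1,
      (∀ n, u n ∈ Catalysis.MFin y) ∧ Tendsto u atTop (𝓝 (Catalysis.pad x)) := by
  -- Halving keeps `ε` strictly below 1 at `n = 0`.
  have key : ∀ n : ℕ, ∃ u ∈ Catalysis.MFin y,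
      ‖u - Catalysis.pad x‖ ≤ 2 * (1 / ((n : ℝ) + 1) / 2) := fun n => by
    have h0 : (0 : ℝ) < 1 / ((n : ℝ) + 1) := by positivity
    have h1 : 1 / ((n : ℝ) + 1) ≤ 1 := by
      rw [div_le_one (by positivity)]; linarith [n.cast_nonneg (α := ℝ)]
    exact Catalysis.exists_mem_MFin_near hx hy hN (by positivity) (by linarith)
  choose u hu hux using key
  refine ⟨u, hu, ?_⟩
  rw [tendsto_iff_norm_sub_tendsto_zero]
  refine squeeze_zero (fun _ => norm_nonneg _) hux ?_
  simpa [mul_div_cancel₀] using tendsto_one_div_add_atTop_nhds_zero_nat (𝕜 := ℝ)
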